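/- For complex $x,q$ with $|q|<1$ let $(x;q)_\infty=\prod_{i=0}^{\infty}(1-xq^i)$. Then for every complex number $q$ with $|q|<1$, $$\sum_{k=0}^{\infty}\frac{1+q^{4k+2}}{(1+q^{2k+1})^2}\,\frac{q^{2k}}{(1-q^{2k+1})^2} =\frac{(-q^2;q^2)_{\infty}^2\,(q^4;q^4)_{\infty}^4}{(q^2;q^4)_{\infty}^2},$$ where the series on the left converges absolutely. -/

import Mathlib

/-- The infinite `q`-shifted factorial `(x; q)_∞ = ∏_{i ≥ 0} (1 - x q ^ i)`, for complex `x`, `q`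
with `‖q‖ < 1`. -/
noncomputable def qShiftedFactorial (x q : ℂ) : ℂ := ∏' i : ℕ, (1 - x * q ^ i)

/-- The product defining `(x; q)_∞` converges (unconditionally) whenever `‖q‖ < 1`. -/
theorem hasProd_qShiftedFactorial (x : ℂ) {q : ℂ} (hq : ‖q‖ < 1) :
    HasProd (fun i : ℕ => 1 - x * q ^ i) (qShiftedFactorial x q) := by
  have h : Summable fun i : ℕ => ‖-(x * q ^ i)‖ := by
    simpa [norm_neg, norm_mul, norm_pow] using
      (summable_geometric_of_lt_one (norm_nonneg q) hq).mul_left ‖x‖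
  have h2 : Multipliable fun i : ℕ => 1 - x * q ^ i := by
    simpa [sub_eq_add_neg] using multipliable_one_add_of_summable h
  exact h2.hasProd

/-!
With `s = q ^ 2`, the `k`-th summand is
`(1 + s ^ (2 * k + 1)) * s ^ k / (1 - s ^ (2 * k + 1)) ^ 2`, and by Euler's identity
`(-s; s)_∞ (s; s²)_∞ = 1` the claimed value is `(s²; s²)_∞⁴ / (s; s²)_∞⁴`. Up to the factor
`(1 - s²) / (1 - s)³`, the series is the very-well-poised `₆φ₅` series `S(z)` to the base `s²` with
parameters `a = s z`, `b = c = d = s` and argument `z`, taken at `z = s`.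

Rogers' product formula for `S(z)` is proved for all `z` in the unit disc (`tsum_poisedTerm`).
A suitable linear combination of the `k`-th terms of `S(z)` and `S(s² z)` is an explicit difference
in `k` (`sum_range_poisedTerm_sub`), so `S(z)` is an explicit rational multiple of `S(s² z)`
(`tsum_poisedTerm_contiguous`). Iterating this `n` times turns the rational factors into partial
products of shifted factorials, while `S(s^(2n) z)` tends to `1` by dominated convergence
(`tendsto_tsum_poisedTerm`), since only the term `k = 0` survives at `z = 0`.
-/

/-! ### Infinite shifted factorials -/

lemma one_sub_le_norm_one_sub {x : ℂ} {r : ℝ} (hx : ‖x‖ ≤ r) : 1 - r ≤ ‖1 - x‖ := by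
  have := norm_sub_norm_le (1 : ℂ) x
  rw [norm_one] at this
  linarith

lemma one_sub_ne_zero_of_norm_lt_one {x : ℂ} (hx : ‖x‖ < 1) : 1 - x ≠ 0 := by
  rw [sub_ne_zero]
  rintro rfl
  simp at hx

lemma norm_sq_lt_one {x : ℂ} (hx : ‖x‖ < 1) : ‖x ^ 2‖ < 1 := by
  rw [norm_pow]
  exact pow_lt_one₀ (norm_nonneg x) hx two_ne_zero

lemma norm_mul_lt_one {x y : ℂ} (hx : ‖x‖ < 1) (hy : ‖y‖ ≤ 1) : ‖x * y‖ < 1 := by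
  rw [norm_mul]
  nlinarith [norm_nonneg x, norm_nonneg y]

lemma norm_pow_le_one_of_lt_one {x : ℂ} (hx : ‖x‖ < 1) (n : ℕ) : ‖x ^ n‖ ≤ 1 := by
  rw [norm_pow]
  exact pow_le_one₀ (norm_nonneg x) hx.le

lemma qShiftedFactorial_ne_zero {x q : ℂ} (hx : ‖x‖ < 1) (hq : ‖q‖ < 1) :
    qShiftedFactorial x q ≠ 0 := by
  have h : Summable fun i : ℕ => ‖-(x * q ^ i)‖ := by
    simpa [norm_neg, norm_mul, norm_pow] using
      (summable_geometric_of_lt_one (norm_nonneg q) hq).mul_left ‖x‖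
  have h2 := tprod_one_add_ne_zero_of_summable (f := fun i : ℕ => -(x * q ^ i)) (fun i => by
    rw [← sub_eq_add_neg]
    exact one_sub_ne_zero_of_norm_lt_one (norm_mul_lt_one hx (norm_pow_le_one_of_lt_one hq i))) h
  simpa only [qShiftedFactorial, sub_eq_add_neg] using h2

lemma qShiftedFactorial_eq_one_sub_mul (x : ℂ) {q : ℂ} (hq : ‖q‖ < 1) :
    qShiftedFactorial x q = (1 - x) * qShiftedFactorial (x * q) q := by
  have h := (hasProd_qShiftedFactorial (x * q) hq).multipliable
  have h2 := tprod_eq_zero_mul' (f := fun i : ℕ => 1 - x * q ^ i)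
    (h.congr fun i => by ring)
  simp only [qShiftedFactorial, h2, pow_zero, mul_one]
  congr 1
  exact tprod_congr fun i => by ring

lemma qShiftedFactorial_even_mul_odd (x : ℂ) {q : ℂ} (hq : ‖q‖ < 1) :
    qShiftedFactorial x (q ^ 2) * qShiftedFactorial (x * q) (q ^ 2) = qShiftedFactorial x q := by
  have hq2 : ‖q ^ 2‖ < 1 := norm_sq_lt_one hq
  refine HasProd.unique (HasProd.even_mul_odd (f := fun i : ℕ => 1 - x * q ^ i) ?_ ?_)
    (hasProd_qShiftedFactorial x hq)
  · simpa only [pow_mul] using hasProd_qShiftedFactorial x hq2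
  · refine (hasProd_qShiftedFactorial (x * q) hq2).congr_fun fun i => ?_
    ring

lemma qShiftedFactorial_mul_neg (x : ℂ) {q : ℂ} (hq : ‖q‖ < 1) :
    qShiftedFactorial x q * qShiftedFactorial (-x) q = qShiftedFactorial (x ^ 2) (q ^ 2) := by
  have hq2 : ‖q ^ 2‖ < 1 := norm_sq_lt_one hq
  refine HasProd.unique ((hasProd_qShiftedFactorial x hq).mul (hasProd_qShiftedFactorial (-x) hq))
    ((hasProd_qShiftedFactorial (x ^ 2) hq2).congr_fun fun i => ?_)
  ring

/-- Euler's identity `(-q; q)_∞ (q; q²)_∞ = 1`. -/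
lemma qShiftedFactorial_neg_mul_odd {q : ℂ} (hq : ‖q‖ < 1) :
    qShiftedFactorial (-q) q * qShiftedFactorial q (q ^ 2) = 1 := by
  have hq2 : ‖q ^ 2‖ < 1 := norm_sq_lt_one hq
  have h1 := qShiftedFactorial_even_mul_odd q hq
  have h2 := qShiftedFactorial_mul_neg q hq
  rw [← pow_two] at h1
  apply mul_right_cancel₀ (qShiftedFactorial_ne_zero hq2 hq2)
  rw [one_mul]
  nth_rw 2 [← h2]
  rw [← h1]
  ring

/-! ### A very-well-poised series -/

/-- The ratio of the `k`-th and `(k+1)`-st products in `poisedProd s z`, where `y = s ^ (2 * k)`. -/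
noncomputable def poisedRatio (s z y : ℂ) : ℂ :=
  (1 - s * z * y) * (1 - s * y) ^ 3 / ((1 - s ^ 2 * y) * (1 - s ^ 2 * z * y) ^ 3) * z

/-- The quotient `(a)_k (s)_k³ / ((s²)_k (a s)_k³) * z ^ k` of finite shifted factorials to the
base `s²`, where `a = s z`. -/
noncomputable def poisedProd (s z : ℂ) (k : ℕ) : ℂ :=
  ∏ i ∈ Finset.range k, poisedRatio s z (s ^ (2 * i))

/-- The `k`-th term of the very-well-poised `₆φ₅` series to the base `s²`, with the parameters
`a = s z` and `b = c = d = s`, whose argument is `z`. -/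
noncomputable def poisedTerm (s z : ℂ) (k : ℕ) : ℂ :=
  (1 - s * z * (s ^ (2 * k)) ^ 2) / (1 - s * z) * poisedProd s z k

lemma poisedProd_succ (s z : ℂ) (k : ℕ) :
    poisedProd s z (k + 1) = poisedProd s z k * poisedRatio s z (s ^ (2 * k)) :=
  Finset.prod_range_succ _ _

/-- A bound that is uniform in `z` and linear at `z = 0`. -/
lemma norm_poisedRatio_le {s z y : ℂ} (hs : ‖s‖ < 1) (hz : ‖z‖ ≤ 1) (hy : ‖y‖ ≤ 1) :
    ‖poisedRatio s z y‖ ≤ 16 / (1 - ‖s‖) ^ 4 * ‖z‖ := by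
  have hzy : ‖z * y‖ ≤ 1 := by
    rw [norm_mul]; exact mul_le_one₀ hz (norm_nonneg y) hy
  have hsx : ∀ x : ℂ, ‖x‖ ≤ 1 → ‖s * x‖ ≤ ‖s‖ := fun x hx => by
    rw [norm_mul]; exact mul_le_of_le_one_right (norm_nonneg s) hx
  have hs2 : ∀ x : ℂ, ‖x‖ ≤ 1 → ‖s ^ 2 * x‖ ≤ ‖s‖ := fun x hx => by
    rw [pow_two, mul_assoc]
    exact hsx _ ((hsx x hx).trans hs.le)
  have up : ∀ x : ℂ, ‖x‖ ≤ ‖s‖ → ‖1 - x‖ ≤ 2 := fun x hx =>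
    (norm_sub_le _ _).trans (by rw [norm_one]; linarith)
  have h0 : 0 < 1 - ‖s‖ := by linarith
  have a1 : ‖1 - s * z * y‖ ≤ 2 := up _ (by rw [mul_assoc]; exact hsx _ hzy)
  have a2 : ‖1 - s * y‖ ≤ 2 := up _ (hsx _ hy)
  have b1 : 1 - ‖s‖ ≤ ‖1 - s ^ 2 * y‖ := one_sub_le_norm_one_sub (hs2 _ hy)
  have b2 : 1 - ‖s‖ ≤ ‖1 - s ^ 2 * z * y‖ :=
    one_sub_le_norm_one_sub (by rw [mul_assoc]; exact hs2 _ hzy)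
  rw [poisedRatio, norm_mul, norm_div, norm_mul, norm_mul, norm_pow, norm_pow]
  gcongr
  · calc ‖1 - s * z * y‖ * ‖1 - s * y‖ ^ 3 ≤ 2 * 2 ^ 3 := by gcongr
      _ = 16 := by norm_num
  · calc (1 - ‖s‖) ^ 4 = (1 - ‖s‖) * (1 - ‖s‖) ^ 3 := by ring
      _ ≤ _ := by gcongr

lemma norm_poisedProd_le {s z : ℂ} (hs : ‖s‖ < 1) (hz : ‖z‖ ≤ 1) (k : ℕ) :
    ‖poisedProd s z k‖ ≤ (16 / (1 - ‖s‖) ^ 4 * ‖z‖) ^ k := by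
  rw [poisedProd, norm_prod]
  calc _ ≤ ∏ i ∈ Finset.range k, (16 / (1 - ‖s‖) ^ 4 * ‖z‖) :=
        Finset.prod_le_prod (fun _ _ => norm_nonneg _)
          fun i _ => norm_poisedRatio_le hs hz (norm_pow_le_one_of_lt_one hs _)
    _ = _ := by simp

/-- The factor by which `poisedTerm` and `poisedProd` differ is bounded. -/
lemma norm_poisedTerm_le {s z : ℂ} (hs : ‖s‖ < 1) (hz : ‖z‖ ≤ 1) (k : ℕ) :
    ‖poisedTerm s z k‖ ≤ 2 / (1 - ‖s‖) * ‖poisedProd s z k‖ := by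
  have hsx : ∀ x : ℂ, ‖x‖ ≤ 1 → ‖s * x‖ ≤ ‖s‖ := fun x hx => by
    rw [norm_mul]; exact mul_le_of_le_one_right (norm_nonneg s) hx
  have hy : ‖z * (s ^ (2 * k)) ^ 2‖ ≤ 1 := by
    rw [norm_mul, ← pow_mul]
    exact mul_le_one₀ hz (norm_nonneg _) (norm_pow_le_one_of_lt_one hs _)
  have h0 : 0 < 1 - ‖s‖ := by linarith
  rw [poisedTerm, norm_mul, norm_div]
  gcongr
  · refine (norm_sub_le _ _).trans ?_
    have := hsx _ hy
    rw [← mul_assoc] at this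
    rw [norm_one]
    linarith
  · exact one_sub_le_norm_one_sub (hsx _ hz)

open Filter Topology in
lemma summable_poisedProd {s z : ℂ} (hs : ‖s‖ < 1) (hz : ‖z‖ < 1) :
    Summable (poisedProd s z) := by
  have hpow : Tendsto (fun k : ℕ => s ^ (2 * k)) atTop (𝓝 0) := by
    simp_rw [pow_mul]
    exact tendsto_pow_atTop_nhds_zero_of_norm_lt_one (norm_sq_lt_one hs)
  have hcont : ContinuousAt (poisedRatio s z) 0 := by
    unfold poisedRatio
    refine ContinuousAt.mul (ContinuousAt.div (by fun_prop) (by fun_prop) (by simp)) (by fun_prop)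
  have hlim : Tendsto (fun k : ℕ => ‖poisedRatio s z (s ^ (2 * k))‖) atTop (𝓝 ‖z‖) := by
    have := (hcont.tendsto.comp hpow).norm
    simpa [poisedRatio, Function.comp_def] using this
  obtain ⟨r, hzr, hr⟩ := exists_between hz
  refine summable_of_ratio_norm_eventually_le hr ?_
  filter_upwards [hlim.eventually_le_const hzr] with k hk
  rw [poisedProd_succ, norm_mul, mul_comm]
  gcongr

lemma summable_poisedTerm {s z : ℂ} (hs : ‖s‖ < 1) (hz : ‖z‖ < 1) :
    Summable (poisedTerm s z) :=
  .of_norm_bounded ((summable_poisedProd hs hz).norm.mul_left _) (norm_poisedTerm_le hs hz.le)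

/-! ### The contiguous relation -/

/-- Replacing `z` by `s² z` shifts the finite factorials in `poisedProd` by one place. -/
lemma poisedProd_sq_mul {s z : ℂ} (hs : ‖s‖ < 1) (hz : ‖z‖ < 1) (k : ℕ) :
    poisedProd s (s ^ 2 * z) k * ((1 - s * z) * (1 - s ^ 2 * z * s ^ (2 * k)) ^ 3) =
      poisedProd s z k *
        (s ^ (2 * k) * (1 - s * z * s ^ (2 * k)) * (1 - s ^ 2 * z) ^ 3) := by
  have hne : ∀ n : ℕ, 1 - s ^ 2 * z * s ^ n ≠ 0 := fun n => by
    apply one_sub_ne_zero_of_norm_lt_one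
    rw [mul_comm (s ^ 2), mul_assoc, ← pow_add]
    exact norm_mul_lt_one hz (norm_pow_le_one_of_lt_one hs _)
  have hne' : ∀ n : ℕ, 1 - s ^ 2 * s ^ n ≠ 0 := fun n => by
    apply one_sub_ne_zero_of_norm_lt_one
    rw [pow_two, mul_assoc]
    exact norm_mul_lt_one hs (norm_mul_lt_one hs (norm_pow_le_one_of_lt_one hs _)).le
  induction k with
  | zero => simp [poisedProd]
  | succ k ih =>
    rw [poisedProd_succ, poisedProd_succ]
    have h1 := hne (2 * k)
    have h2 := hne (2 * (k + 1))
    have h3 := hne' (2 * k)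
    have h4 : s ^ (2 * (k + 1)) = s ^ 2 * s ^ (2 * k) := by ring
    rw [h4] at h2 ⊢
    set y := s ^ (2 * k)
    have h5 : 1 - s ^ 2 * (s ^ 2 * z) * y ≠ 0 := by
      convert h2 using 1; ring
    unfold poisedRatio
    generalize poisedProd s z k = P at *
    generalize poisedProd s (s ^ 2 * z) k = P' at *
    have e1 : P' * (1 - s * z) = P * (y * (1 - s * z * y) * (1 - s ^ 2 * z) ^ 3) /
        (1 - s ^ 2 * z * y) ^ 3 := by
      rw [eq_div_iff (pow_ne_zero 3 h1), ← ih]; ring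
    calc _ = (P' * (1 - s * z)) * ((1 - s * (s ^ 2 * z) * y) * (1 - s * y) ^ 3 / ((1 - s ^ 2 * y)
          * (1 - s ^ 2 * (s ^ 2 * z) * y) ^ 3) * (s ^ 2 * z) *
          (1 - s ^ 2 * z * (s ^ 2 * y)) ^ 3) := by ring
      _ = _ := by
        rw [e1, show s ^ 2 * z * (s ^ 2 * y) = s ^ 2 * (s ^ 2 * z) * y by ring]
        generalize 1 - s ^ 2 * (s ^ 2 * z) * y = A at h5 ⊢
        generalize 1 - s ^ 2 * z * y = B at h1 ⊢
        field_simp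

/-- The contiguous relation for `poisedTerm`: the antidifference is a constant multiple of
`(1 - s ^ (2 * n)) * (1 - s * z ^ 2 * s ^ (2 * n)) * poisedProd s z n`. It vanishes at `n = 0`, and
its polynomial factors are forced by comparing degrees and values in `y = s ^ (2 * n)`. -/
lemma sum_range_poisedTerm_sub {s z : ℂ} (hs : ‖s‖ < 1) (hz : ‖z‖ < 1) (n : ℕ) :
    ∑ k ∈ Finset.range n, ((1 - z) * (1 - s ^ 2 * z) ^ 3 * poisedTerm s z k
        - (1 - s ^ 3 * z) * (1 - s * z) ^ 3 * poisedTerm s (s ^ 2 * z) k) =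
      -((1 - s ^ (2 * n)) * (1 - s * z ^ 2 * s ^ (2 * n)) * poisedProd s z n
        * (1 - s ^ 2 * z) ^ 3 / (1 - s * z)) := by
  have hsz : 1 - s * z ≠ 0 := one_sub_ne_zero_of_norm_lt_one (norm_mul_lt_one hs hz.le)
  have hs3z : 1 - s ^ 3 * z ≠ 0 := one_sub_ne_zero_of_norm_lt_one <| by
    rw [mul_comm]; exact norm_mul_lt_one hz (norm_pow_le_one_of_lt_one hs 3)
  induction n with
  | zero => simp
  | succ n ih =>
    have hne : 1 - s ^ 2 * z * s ^ (2 * n) ≠ 0 := by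
      apply one_sub_ne_zero_of_norm_lt_one
      rw [mul_comm (s ^ 2), mul_assoc, ← pow_add]
      exact norm_mul_lt_one hz (norm_pow_le_one_of_lt_one hs _)
    have hne' : 1 - s ^ 2 * s ^ (2 * n) ≠ 0 := by
      apply one_sub_ne_zero_of_norm_lt_one
      rw [pow_two, mul_assoc]
      exact norm_mul_lt_one hs (norm_mul_lt_one hs (norm_pow_le_one_of_lt_one hs _)).le
    have hP := poisedProd_sq_mul hs hz n
    rw [Finset.sum_range_succ, ih, poisedProd_succ,
      show s ^ (2 * (n + 1)) = s ^ 2 * s ^ (2 * n) by ring]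
    unfold poisedTerm poisedRatio
    set y := s ^ (2 * n)
    generalize poisedProd s z n = P at *
    generalize poisedProd s (s ^ 2 * z) n = P' at *
    have e1 : P' = P * (y * (1 - s * z * y) * (1 - s ^ 2 * z) ^ 3) /
        ((1 - s * z) * (1 - s ^ 2 * z * y) ^ 3) := by
      rw [eq_div_iff (mul_ne_zero hsz (pow_ne_zero 3 hne)), hP]
    rw [e1, show s * (s ^ 2 * z) = s ^ 3 * z by ring]
    -- The denominators are kept as single letters while they are cleared.
    clear ih hP e1
    generalize hA : 1 - s ^ 2 * z * y = A at hne ⊢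
    generalize hB : 1 - s ^ 2 * y = B at hne' ⊢
    generalize hC : 1 - s * z = C at hsz ⊢
    generalize hE : 1 - s ^ 3 * z = E at hs3z ⊢
    field_simp
    subst hA hB hC hE
    ring

open Filter Topology in
/-- The series at `z` and at `s² z` are proportional: the antidifference in
`sum_range_poisedTerm_sub` vanishes at both ends. -/
lemma tsum_poisedTerm_contiguous {s z : ℂ} (hs : ‖s‖ < 1) (hz : ‖z‖ < 1) :
    (1 - z) * (1 - s ^ 2 * z) ^ 3 * ∑' k, poisedTerm s z k =
      (1 - s ^ 3 * z) * (1 - s * z) ^ 3 * ∑' k, poisedTerm s (s ^ 2 * z) k := by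
  have hz' : ‖s ^ 2 * z‖ < 1 := by
    rw [mul_comm]; exact norm_mul_lt_one hz (norm_pow_le_one_of_lt_one hs 2)
  have h1 := ((summable_poisedTerm hs hz).hasSum.mul_left ((1 - z) * (1 - s ^ 2 * z) ^ 3)).sub
    ((summable_poisedTerm hs hz').hasSum.mul_left ((1 - s ^ 3 * z) * (1 - s * z) ^ 3))
  have h2 := h1.tendsto_sum_nat
  simp_rw [sum_range_poisedTerm_sub hs hz] at h2
  have hpow : Tendsto (fun k : ℕ => s ^ (2 * k)) atTop (𝓝 0) := by
    simp_rw [pow_mul]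
    exact tendsto_pow_atTop_nhds_zero_of_norm_lt_one (norm_sq_lt_one hs)
  have h3 : Tendsto (fun n : ℕ => -((1 - s ^ (2 * n)) * (1 - s * z ^ 2 * s ^ (2 * n))
      * poisedProd s z n * (1 - s ^ 2 * z) ^ 3 / (1 - s * z))) atTop (𝓝 0) := by
    have := (((((hpow.const_sub 1).mul ((hpow.const_mul (s * z ^ 2)).const_sub 1)).mul
      (summable_poisedProd hs hz).tendsto_atTop_zero).mul_const
        ((1 - s ^ 2 * z) ^ 3)).div_const (1 - s * z)).neg
    simpa using this
  exact sub_eq_zero.mp (tendsto_nhds_unique h2 h3)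

/-! ### Summation of the series -/

open Filter Topology in
lemma tendsto_tsum_poisedTerm {s z : ℂ} (hs : ‖s‖ < 1) (hz : ‖z‖ < 1) :
    Tendsto (fun n : ℕ => ∑' k, poisedTerm s (z * (s ^ 2) ^ n) k) atTop (𝓝 1) := by
  set K : ℝ := 16 / (1 - ‖s‖) ^ 4
  have hs0 : 0 < 1 - ‖s‖ := by linarith
  have hw : Tendsto (fun n : ℕ => z * (s ^ 2) ^ n) atTop (𝓝 0) := by
    have : ‖s ^ 2‖ < 1 := norm_sq_lt_one hs
    simpa using (tendsto_pow_atTop_nhds_zero_of_norm_lt_one this).const_mul z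
  have hKw : Tendsto (fun n : ℕ => K * ‖z * (s ^ 2) ^ n‖) atTop (𝓝 0) := by
    simpa using hw.norm.const_mul K
  have hle : ∀ n : ℕ, ‖z * (s ^ 2) ^ n‖ ≤ 1 := fun n => by
    rw [← pow_mul]; exact (norm_mul_lt_one hz (norm_pow_le_one_of_lt_one hs _)).le
  have hbd : ∀ n k : ℕ, ‖poisedTerm s (z * (s ^ 2) ^ n) k‖ ≤
      2 / (1 - ‖s‖) * (K * ‖z * (s ^ 2) ^ n‖) ^ k := fun n k =>
    (norm_poisedTerm_le hs (hle n) k).trans (by gcongr; exact norm_poisedProd_le hs (hle n) k)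
  have key := tendsto_tsum_of_dominated_convergence (𝓕 := atTop)
    (f := fun (n k : ℕ) => poisedTerm s (z * (s ^ 2) ^ n) k)
    (g := fun k : ℕ => if k = 0 then (1 : ℂ) else 0)
    (bound := fun k : ℕ => 2 / (1 - ‖s‖) * (1 / 2 : ℝ) ^ k)
    (summable_geometric_two.mul_left _) ?_ ?_
  · rwa [tsum_ite_eq] at key
  · rintro (_ | k)
    · refine tendsto_const_nhds.congr fun n => ?_
      have : 1 - s * (z * (s ^ 2) ^ n) ≠ 0 :=
        one_sub_ne_zero_of_norm_lt_one (norm_mul_lt_one hs (hle n))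
      simp [poisedTerm, poisedProd, this]
    · refine squeeze_zero_norm (fun n => hbd n (k + 1)) ?_
      simpa using (hKw.pow (k + 1)).const_mul (2 / (1 - ‖s‖))
  · filter_upwards [hKw.eventually_le_const (show (0 : ℝ) < 1 / 2 by norm_num)] with n hn k
    exact (hbd n k).trans (by gcongr)

open Filter Topology in
/-- Rogers' sum of the very-well-poised `₆φ₅` series, for the parameters of `poisedTerm`: iterate
the contiguous relation and let `z → 0`. -/
lemma tsum_poisedTerm {s z : ℂ} (hs : ‖s‖ < 1) (hz : ‖z‖ < 1) :
    qShiftedFactorial z (s ^ 2) * qShiftedFactorial (s ^ 2 * z) (s ^ 2) ^ 3 *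
        ∑' k, poisedTerm s z k =
      qShiftedFactorial (s ^ 3 * z) (s ^ 2) * qShiftedFactorial (s * z) (s ^ 2) ^ 3 := by
  have hs2 : ‖s ^ 2‖ < 1 := norm_sq_lt_one hs
  have hiter : ∀ n : ℕ,
      (∏ i ∈ Finset.range n, (1 - z * (s ^ 2) ^ i)) *
        (∏ i ∈ Finset.range n, (1 - s ^ 2 * z * (s ^ 2) ^ i)) ^ 3 * ∑' k, poisedTerm s z k =
      (∏ i ∈ Finset.range n, (1 - s ^ 3 * z * (s ^ 2) ^ i)) *
        (∏ i ∈ Finset.range n, (1 - s * z * (s ^ 2) ^ i)) ^ 3 *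
          ∑' k, poisedTerm s (z * (s ^ 2) ^ n) k := by
    intro n
    induction n with
    | zero => simp
    | succ n ih =>
      have h := tsum_poisedTerm_contiguous hs (z := z * (s ^ 2) ^ n)
        (norm_mul_lt_one hz (norm_pow_le_one_of_lt_one hs2 n))
      rw [show s ^ 2 * (z * (s ^ 2) ^ n) = z * (s ^ 2) ^ (n + 1) by ring] at h
      simp only [Finset.prod_range_succ]
      linear_combination (1 - z * (s ^ 2) ^ n) * (1 - s ^ 2 * z * (s ^ 2) ^ n) ^ 3 * ih +
        (∏ i ∈ Finset.range n, (1 - s ^ 3 * z * (s ^ 2) ^ i)) *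
        (∏ i ∈ Finset.range n, (1 - s * z * (s ^ 2) ^ i)) ^ 3 * h
  have lim : ∀ x : ℂ, Tendsto (fun n => ∏ i ∈ Finset.range n, (1 - x * (s ^ 2) ^ i)) atTop
      (𝓝 (qShiftedFactorial x (s ^ 2))) := fun x =>
    (hasProd_qShiftedFactorial x hs2).tendsto_prod_nat
  have hL := ((lim z).mul ((lim (s ^ 2 * z)).pow 3)).mul_const (∑' k, poisedTerm s z k)
  have hR := ((lim (s ^ 3 * z)).mul ((lim (s * z)).pow 3)).mul (tendsto_tsum_poisedTerm hs hz)
  rw [mul_one] at hR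
  exact tendsto_nhds_unique (hL.congr hiter) hR

/-- At `z = s` the finite factorials telescope. -/
lemma poisedProd_self {s : ℂ} (hs : ‖s‖ < 1) (k : ℕ) :
    poisedProd s s k = ((1 - s) / (1 - s ^ (2 * k + 1))) ^ 3 * s ^ k := by
  have hne : ∀ n : ℕ, 1 - s ^ (n + 1) ≠ 0 := fun n => by
    apply one_sub_ne_zero_of_norm_lt_one
    rw [pow_succ']
    exact norm_mul_lt_one hs (norm_pow_le_one_of_lt_one hs _)
  induction k with
  | zero => simp [poisedProd, by simpa using hne 0]
  | succ k ih =>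
    have h1 := hne (2 * k)
    have h2 := hne (2 * k + 1)
    have h3 := hne (2 * k + 2)
    rw [poisedProd_succ, ih, poisedRatio,
      show s * s * s ^ (2 * k) = s ^ (2 * k + 1 + 1) by ring,
      show s ^ 2 * s * s ^ (2 * k) = s ^ (2 * k + 2 + 1) by ring,
      show s ^ 2 * s ^ (2 * k) = s ^ (2 * k + 1 + 1) by ring,
      show s * s ^ (2 * k) = s ^ (2 * k + 1) by ring,
      show 2 * (k + 1) + 1 = 2 * k + 2 + 1 by ring, pow_succ s k]
    generalize 1 - s ^ (2 * k + 1) = A at *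
    generalize 1 - s ^ (2 * k + 1 + 1) = B at *
    generalize 1 - s ^ (2 * k + 2 + 1) = C at *
    field_simp

theorem theorem2 (q : ℂ) (hq : ‖q‖ < 1) :
    HasSum
      (fun k : ℕ => (1 + q ^ (4 * k + 2)) / (1 + q ^ (2 * k + 1)) ^ 2
        * (q ^ (2 * k) / (1 - q ^ (2 * k + 1)) ^ 2))
      (qShiftedFactorial (-q ^ 2) (q ^ 2) ^ 2 * qShiftedFactorial (q ^ 4) (q ^ 4) ^ 4
        / qShiftedFactorial (q ^ 2) (q ^ 4) ^ 2) := by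
  have hs : ‖q ^ 2‖ < 1 := norm_sq_lt_one hq
  rw [show q ^ 4 = (q ^ 2) ^ 2 by ring]
  -- Both sides depend on `q` through `s = q ^ 2` only.
  have hterm : ∀ k : ℕ, (1 + q ^ (4 * k + 2)) / (1 + q ^ (2 * k + 1)) ^ 2
        * (q ^ (2 * k) / (1 - q ^ (2 * k + 1)) ^ 2) =
      (1 + (q ^ 2) ^ (2 * k + 1)) * (q ^ 2) ^ k / (1 - (q ^ 2) ^ (2 * k + 1)) ^ 2 := fun k => by
    rw [div_mul_div_comm, ← mul_pow]
    congr 2 <;> ring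
  simp_rw [hterm]
  generalize q ^ 2 = s at hs
  have hs2 : ‖s ^ 2‖ < 1 := norm_sq_lt_one hs
  have h1s : 1 - s ≠ 0 := one_sub_ne_zero_of_norm_lt_one hs
  have h1s2 : 1 - s ^ 2 ≠ 0 := one_sub_ne_zero_of_norm_lt_one hs2
  have hfun : ∀ k : ℕ, (1 + s ^ (2 * k + 1)) * s ^ k / (1 - s ^ (2 * k + 1)) ^ 2 =
      (1 - s ^ 2) / (1 - s) ^ 3 * poisedTerm s s k := fun k => by
    have hk : 1 - s ^ (2 * k + 1) ≠ 0 := one_sub_ne_zero_of_norm_lt_one <| by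
      rw [pow_succ']; exact norm_mul_lt_one hs (norm_pow_le_one_of_lt_one hs _)
    rw [poisedTerm, poisedProd_self hs, ← pow_two,
      show 1 - s ^ 2 * (s ^ (2 * k)) ^ 2 = (1 - s ^ (2 * k + 1)) * (1 + s ^ (2 * k + 1)) by ring]
    generalize s ^ (2 * k + 1) = A at *
    generalize 1 - s ^ 2 = B at *
    field_simp
  have hval : qShiftedFactorial (-s) s ^ 2 * qShiftedFactorial (s ^ 2) (s ^ 2) ^ 4
      / qShiftedFactorial s (s ^ 2) ^ 2 =
      (1 - s ^ 2) / (1 - s) ^ 3 * ∑' k, poisedTerm s s k := by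
    have hO := qShiftedFactorial_eq_one_sub_mul s hs2
    have hE := qShiftedFactorial_eq_one_sub_mul (s ^ 2) hs2
    have hsum := tsum_poisedTerm hs hs
    have heuler := qShiftedFactorial_neg_mul_odd hs
    have hO0 := qShiftedFactorial_ne_zero hs hs2
    rw [show s * s ^ 2 = s ^ 2 * s by ring] at hO
    rw [show s ^ 2 * s ^ 2 = s ^ 3 * s by ring] at hE
    rw [← pow_two s] at hsum
    rw [eq_div_of_mul_eq hO0 heuler]
    set O := qShiftedFactorial s (s ^ 2)
    set E := qShiftedFactorial (s ^ 2) (s ^ 2)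
    have hO' : qShiftedFactorial (s ^ 2 * s) (s ^ 2) = O / (1 - s) := by
      rw [eq_div_iff h1s, hO]; ring
    have hE' : qShiftedFactorial (s ^ 3 * s) (s ^ 2) = E / (1 - s ^ 2) := by
      rw [eq_div_iff h1s2, hE]; ring
    rw [hO', hE'] at hsum
    have hS : ∑' k, poisedTerm s s k = (E / (1 - s ^ 2) * E ^ 3) / (O * (O / (1 - s)) ^ 3) := by
      rw [eq_div_iff (mul_ne_zero hO0 (pow_ne_zero 3 (div_ne_zero hO0 h1s))), ← hsum]; ring
    rw [hS]
    generalize 1 - s ^ 2 = B at *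
    field_simp
  simp_rw [hfun, hval]
  exact (summable_poisedTerm hs hs).hasSum.mul_left _
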